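/- All matroids are on finite ground sets. The Tutte polynomial of a matroid $M$ on $E$ with rank function $\operatorname{rk}$ is $T_M(x,y)=\sum_{A\subseteq E}(x-1)^{\operatorname{rk}(E)-\operatorname{rk}(A)}(y-1)^{|A|-\operatorname{rk}(A)}\in\mathbb{Z}[x,y]$. A matroid is uniform if every subset of its ground set of cardinality equal to the rank is a basis. Let $M$ be a matroid of rank $k$ on $E$. A subset $A\subseteq E$ is stressed if the restriction $M|_A$ and the contraction $M/A$ are both uniform; its cusp is the family of $k$-subsets $S\subseteq E$ with $|S\cap A|\ge \operatorname{rk}(A)+1$; relaxing a stressed subset means adding its cusp to the bases. The matroid $M$ is elementary split if relaxing all its stressed subsets with non-empty cusp yields a uniform matroid, i.e. if every $k$-subset of $E$ is a basis of $M$ or lies in the cusp of a stressed subset of $M$. It is a Schubert (or nested) matroid if its cyclic flats (flats that are unions of circuits, the empty union being allowed) form a chain under inclusion. It is cuspidal if it is both elementary split and Schubert. Theorem. Let $0\le k\le n$ be integers. Up to isomorphism there are exactly $k(n-k)+1$ cuspidal matroids of rank $k$ on $n$ elements. Let $\Lambda_0,\dots,\Lambda_{k(n-k)}$ be representatives of their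 isomorphism classes. Then for every matroid $M$ of rank $k$ on $n$ elements there are unique integers $c_0,\dots,c_{k(n-k)}$ such that \[ T_M(x,y)=\sum_{i=0}^{k(n-k)} c_i\, T_{\Lambda_i}(x,y). \] -/

import Mathlib

namespace Matroid

/-- The Tutte polynomial `T_M(x, y) = ∑_{A ⊆ E} (x - 1)^(rk E - rk A) (y - 1)^(|A| - rk A)` of a
matroid on a finite ground set, with `x = X 0` and `y = X 1`. -/
noncomputable def tutte {α : Type*} (M : Matroid α) [M.Finite] : MvPolynomial (Fin 2) ℤ :=
  ∑ A ∈ M.ground_finite.toFinset.powerset,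
    (MvPolynomial.X 0 - 1) ^ (M.eRank.toNat - (M.eRk (A : Set α)).toNat) *
      (MvPolynomial.X 1 - 1) ^ (A.card - (M.eRk (A : Set α)).toNat)

/-- `M` is uniform: all subsets of the ground set of cardinality `rk M` are bases. -/
def IsUniform {α : Type*} (M : Matroid α) : Prop :=
  ∀ B ⊆ M.E, B.encard = M.eRank → M.IsBase B

/-- `A` is stressed in `M`: the restriction to `A` and the contraction of `A` are both uniform. -/
def IsStressed {α : Type*} (M : Matroid α) (A : Set α) : Prop :=
  A ⊆ M.E ∧ (M ↾ A).IsUniform ∧ (M ／ A).IsUniform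

/-- The cusp of `A`: the sets `S ⊆ E` with `|S| = rk M` and `|S ∩ A| ≥ rk A + 1`. -/
def cusp {α : Type*} (M : Matroid α) (A : Set α) : Set (Set α) :=
  {S | S ⊆ M.E ∧ S.encard = M.eRank ∧ M.eRk A + 1 ≤ (S ∩ A).encard}

/-- The bases of the matroid obtained from `M` by relaxing all stressed subsets with non-empty
cusp: relaxing `A` adds the members of the cusp of `A` to the bases. -/
def relaxedBases {α : Type*} (M : Matroid α) : Set (Set α) :=
  {B | M.IsBase B} ∪ ⋃ A ∈ {A | M.IsStressed A ∧ (M.cusp A).Nonempty}, M.cusp A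

/-- `M` is elementary split: relaxing all stressed subsets with non-empty cusp yields a uniform
matroid, i.e. the uniform matroid on the same ground set and of the same rank. -/
def IsElementarySplit {α : Type*} (M : Matroid α) : Prop :=
  M.relaxedBases = {S | S ⊆ M.E ∧ S.encard = M.eRank}

/-- A cyclic flat: a flat that is a (possibly empty) union of circuits. -/
def IsCyclicFlat {α : Type*} (M : Matroid α) (F : Set α) : Prop :=
  M.IsFlat F ∧ ∃ 𝒞 : Set (Set α), (∀ C ∈ 𝒞, M.IsCircuit C) ∧ F = ⋃₀ 𝒞

/-- `M` is a Schubert (nested) matroid: its cyclic flats form a chain. -/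
def IsSchubert {α : Type*} (M : Matroid α) : Prop :=
  IsChain (· ⊆ ·) {F | M.IsCyclicFlat F}

/-- `M` is cuspidal: it is both Schubert and elementary split. -/
def IsCuspidal {α : Type*} (M : Matroid α) : Prop :=
  M.IsSchubert ∧ M.IsElementarySplit

/-- The Tutte polynomial is an isomorphism invariant. -/
theorem tutte_mapEquiv {α β : Type*} (M : Matroid α) [M.Finite] (e : α ≃ β)
    [(M.mapEquiv e).Finite] : (M.mapEquiv e).tutte = M.tutte := by
  classical
  have hrk : ∀ A ⊆ M.E, (M.mapEquiv e).eRk (e '' A) = M.eRk A := by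
    intro A hA
    have h := eRk_map M (f := e) e.injective.injOn hA
    rwa [mapEquiv_eq_map]
  have hrank : (M.mapEquiv e).eRank = M.eRank := by
    have h := hrk M.E subset_rfl
    rw [eRk_ground] at h
    rw [← h, eRank_def, mapEquiv_ground_eq]
  unfold tutte
  symm
  refine Finset.sum_bij' (fun A _ => A.map e.toEmbedding) (fun A _ => A.map e.symm.toEmbedding)
    ?_ ?_ ?_ ?_ ?_
  · intro A hA
    simp only [Finset.mem_powerset, ← Finset.coe_subset, Set.Finite.coe_toFinset] at hA ⊢
    simpa using hA
  · intro A hA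
    simp only [Finset.mem_powerset, ← Finset.coe_subset, Set.Finite.coe_toFinset] at hA ⊢
    simpa [Equiv.symm_image_subset] using hA
  · intro A _
    simp [Finset.map_map]
  · intro A _
    simp [Finset.map_map]
  · intro A hA
    simp only [Finset.mem_powerset, ← Finset.coe_subset, Set.Finite.coe_toFinset] at hA
    simp [hrank, hrk _ hA]

/-- The cuspidal matroids of rank `k` on the ground set `Fin n`. -/
def CuspidalOn (n k : ℕ) : Type :=
  {M : Matroid (Fin n) // M.E = Set.univ ∧ M.eRank = k ∧ M.IsCuspidal}

/-- Isomorphism of cuspidal matroids on `Fin n`: one is obtained from the other by relabelling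
the elements. -/
instance cuspidalSetoid (n k : ℕ) : Setoid (CuspidalOn n k) where
  r M N := ∃ e : Fin n ≃ Fin n, M.1.mapEquiv e = N.1
  iseqv := by
    refine ⟨fun M => ⟨Equiv.refl _, ?_⟩, ?_, ?_⟩
    · ext <;> simp
    · rintro M N ⟨e, he⟩
      refine ⟨e.symm, ?_⟩
      rw [← he]
      ext <;> simp
    · rintro M N P ⟨e, he⟩ ⟨f, hf⟩
      refine ⟨e.trans f, ?_⟩
      rw [← hf, ← he]
      ext <;> simp [Set.image_image]

/-- The isomorphism classes of cuspidal matroids of rank `k` on `n` elements. -/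
def CuspidalClass (n k : ℕ) : Type := Quotient (cuspidalSetoid n k)

/-- The Tutte polynomial of an isomorphism class of cuspidal matroids. -/
noncomputable def CuspidalClass.tutte {n k : ℕ} (q : CuspidalClass n k) :
    MvPolynomial (Fin 2) ℤ :=
  Quotient.lift (fun M : CuspidalOn n k => M.1.tutte) (by
    rintro M N ⟨e, he⟩
    have h := tutte_mapEquiv M.1 e
    simp only [he] at h
    exact h.symm) q

end Matroid

/-!
Call `k - rk A` the corank and `|A| - rk A` the nullity of a set `A`. In a uniform matroid a set of
corank `p` and nullity `q` in `M` would have corank `p - min p q` and nullity `q - min p q`. Hence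
`T_M` is the Tutte polynomial of the uniform matroid plus one excess
`(x - 1)^p (y - 1)^q - (x - 1)^(p - min p q) (y - 1)^(q - min p q)` for each set, and only the
excesses with `1 ≤ p ≤ k` and `1 ≤ q ≤ n - k` are non-zero. Together with the uniform Tutte
polynomial these are `k (n - k) + 1` linearly independent polynomials.

A non-uniform cuspidal matroid has exactly one stressed set `A` with non-empty cusp: such sets are
cyclic flats, so two of them are nested, and a dependent flat contained in a set with uniform
restriction is equal to it. The bases are then the `k`-sets meeting `A` in at most `r = rk A`
elements, so the isomorphism class is determined by `r` and `|A|`. A set `S` has an excess only if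
`k - r - |S \ A|` and `|S ∩ A| - r` are positive, and its excess has these exponents. They are
maximal exactly for `S = A`, so the change of basis is unitriangular.
-/

section Unitriangular

open Submodule

variable {ι R V : Type*} [Ring R] [AddCommGroup V] [Module R V] {e T : ι → V}

theorem span_range_eq_of_sub_mem_span_image_Iio [Preorder ι] [WellFoundedLT ι]
    (h : ∀ i, T i - e i ∈ span R (e '' Set.Iio i)) :
    span R (Set.range T) = span R (Set.range e) := by
  refine le_antisymm (span_le.2 ?_) (span_le.2 ?_)
  · rintro _ ⟨i, rfl⟩
    have hi := span_mono (Set.image_subset_range e _) (h i)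
    exact (sub_mem_iff_left _ (subset_span (Set.mem_range_self i))).1 hi
  · rintro _ ⟨i, rfl⟩
    induction i using WellFoundedLT.induction with
    | _ i ih =>
      have hle : span R (e '' Set.Iio i) ≤ span R (Set.range T) :=
        span_le.2 (Set.image_subset_iff.2 ih)
      exact (sub_mem_iff_right _ (subset_span (Set.mem_range_self i))).1 (hle (h i))

theorem linearIndependent_of_sub_mem_span_image_Iio [PartialOrder ι]
    (he : LinearIndependent R e) (h : ∀ i, T i - e i ∈ span R (e '' Set.Iio i)) :
    LinearIndependent R T := by
  classical
  rw [linearIndependent_iff]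
  intro c hc
  by_contra hne
  obtain ⟨i, hi⟩ := c.support.exists_maximal (Finsupp.support_nonempty_iff.2 hne)
  have h_span : ∀ j, ¬ i < j → T j - e j ∈ span R (e '' (Set.univ \ {i})) := fun j hij =>
    span_mono (Set.image_mono fun l hl =>
      Set.mem_sdiff_singleton.2 ⟨trivial, by rintro rfl; exact hij hl⟩) (h j)
  have h_other : ∀ j ∈ c.support.erase i, c j • T j ∈ span R (e '' (Set.univ \ {i})) := by
    intro j hj
    obtain ⟨hji, hj⟩ := Finset.mem_erase.1 hj
    have hej : e j ∈ span R (e '' (Set.univ \ {i})) := subset_span ⟨j, ⟨trivial, hji⟩, rfl⟩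
    exact smul_mem _ _ ((sub_mem_iff_left _ hej).1 (h_span j (hi.not_gt hj)))
  rw [Finsupp.linearCombination_apply, Finsupp.sum, ← Finset.add_sum_erase _ _ hi.prop] at hc
  have h_lead : c i • e i ∈ span R (e '' (Set.univ \ {i})) := by
    have h_eq : c i • e i = -(∑ j ∈ c.support.erase i, c j • T j) - c i • (T i - e i) := by
      rw [← eq_neg_of_add_eq_zero_left hc, smul_sub, sub_sub_cancel]
    exact h_eq ▸ sub_mem (neg_mem (sum_mem h_other)) (smul_mem _ _ (h_span i (lt_irrefl i)))
  exact Finsupp.mem_support_iff.1 hi.prop (he.eq_zero_of_smul_mem_span i _ h_lead)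

end Unitriangular

section TuttePolynomials

open MvPolynomial

/-- The polynomial `(x - 1) ^ p * (y - 1) ^ q` contributed to a Tutte polynomial by a subset of
corank `p` and nullity `q`, for `a = (p, q)`. -/
noncomputable def tutteMonomial (a : ℕ × ℕ) : MvPolynomial (Fin 2) ℤ :=
  (X 0 - 1) ^ a.1 * (X 1 - 1) ^ a.2

/-- The difference between the monomial with exponents `(p, q)` and the monomial obtained from it
by dividing by the largest possible power of `(x - 1) * (y - 1)`: the amount by which a subset of
corank `p` and nullity `q` changes the Tutte polynomial of the uniform matroid. -/
noncomputable def tutteExcess (a : ℕ × ℕ) : MvPolynomial (Fin 2) ℤ :=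
  tutteMonomial a - tutteMonomial (a.1 - a.2, a.2 - a.1)

/-- The Tutte polynomial of the uniform matroid of rank `k` on `n` elements. -/
noncomputable def uniformTutte (n k : ℕ) : MvPolynomial (Fin 2) ℤ :=
  ∑ s ∈ Finset.range (n + 1), n.choose s • tutteMonomial (k - s, s - k)

/-- The coefficient of `(x - 1) ^ p * (y - 1) ^ q`, for `a = (p, q)`. -/
noncomputable def shiftedCoeff (a : ℕ × ℕ) : MvPolynomial (Fin 2) ℤ →ₗ[ℤ] ℤ :=
  lcoeff ℤ (Finsupp.single 0 a.1 + Finsupp.single 1 a.2) ∘ₗ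
    (aeval fun i => (X i + 1 : MvPolynomial (Fin 2) ℤ)).toLinearMap

theorem shiftedCoeff_tutteMonomial (a b : ℕ × ℕ) :
    shiftedCoeff a (tutteMonomial b) = if b = a then 1 else 0 := by
  have h_monomial : (X 0 : MvPolynomial (Fin 2) ℤ) ^ b.1 * X 1 ^ b.2 =
      monomial (Finsupp.single 0 b.1 + Finsupp.single 1 b.2) 1 := by
    simp only [X_pow_eq_monomial, monomial_mul, mul_one]
  have h_exponent : (Finsupp.single (0 : Fin 2) b.1 + Finsupp.single 1 b.2 =
      Finsupp.single 0 a.1 + Finsupp.single 1 a.2) ↔ b = a := by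
    simp [Finsupp.ext_iff, Fin.forall_fin_two, Prod.ext_iff]
  simp [shiftedCoeff, tutteMonomial, h_monomial, coeff_monomial, h_exponent]

theorem shiftedCoeff_tutteExcess (a b : ℕ × ℕ) :
    shiftedCoeff a (tutteExcess b) =
      (if b = a then 1 else 0) - if (b.1 - b.2, b.2 - b.1) = a then 1 else 0 := by
  simp only [tutteExcess, map_sub, shiftedCoeff_tutteMonomial]

theorem shiftedCoeff_uniformTutte (a : ℕ × ℕ) (n k : ℕ) :
    shiftedCoeff a (uniformTutte n k) =
      ∑ s ∈ Finset.range (n + 1), n.choose s • if (k - s, s - k) = a then 1 else 0 := by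
  simp only [uniformTutte, map_sum, map_nsmul, shiftedCoeff_tutteMonomial]

theorem shiftedCoeff_uniformTutte_of_pos {a : ℕ × ℕ} (h₁ : 0 < a.1) (h₂ : 0 < a.2) (n k : ℕ) :
    shiftedCoeff a (uniformTutte n k) = 0 := by
  rw [shiftedCoeff_uniformTutte]
  refine Finset.sum_eq_zero fun s _ => ?_
  rw [if_neg (by grind), smul_zero]

theorem shiftedCoeff_uniformTutte_rank (n k : ℕ) : shiftedCoeff (k, 0) (uniformTutte n k) = 1 := by
  rw [shiftedCoeff_uniformTutte, Finset.sum_eq_single 0]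
  · simp
  · intro s _ hs
    rw [if_neg (by grind), smul_zero]
  · simp

theorem tutteExcess_eq_zero {a : ℕ × ℕ} (h : a.1 = 0 ∨ a.2 = 0) : tutteExcess a = 0 := by
  obtain ⟨p, q⟩ := a
  obtain rfl | rfl := h <;> simp [tutteExcess]

/-- The exponents `(p + 1, q + 1)`. The shift leaves out the exponents for which `tutteExcess`
vanishes. -/
def succPair {k m : ℕ} (x : Fin k × Fin m) : ℕ × ℕ :=
  ((x.1 : ℕ) + 1, (x.2 : ℕ) + 1)

theorem succPair_le {k m : ℕ} (x : Fin k × Fin m) : succPair x ≤ (k, m) :=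
  ⟨x.1.isLt, x.2.isLt⟩

theorem succPair_lt_succPair {k m : ℕ} {x y : Fin k × Fin m} :
    succPair x < succPair y ↔ x < y := by
  simp only [succPair, Prod.lt_iff, add_lt_add_iff_right, add_le_add_iff_right, Fin.val_fin_lt,
    Fin.val_fin_le]

theorem succPair_injective {k m : ℕ} :
    Function.Injective (succPair : Fin k × Fin m → ℕ × ℕ) := by
  intro x y h
  simpa only [succPair, Prod.mk.injEq, add_left_inj, Fin.val_inj, ← Prod.ext_iff] using h

/-- A basis of the span of the Tutte polynomials of all matroids of rank `k` on `k + m`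
elements. -/
noncomputable def tutteBasis (k m : ℕ) : WithBot (Fin k × Fin m) → MvPolynomial (Fin 2) ℤ
  | ⊥ => uniformTutte (k + m) k
  | WithBot.some x => tutteExcess (succPair x)

/-- The exponents of a monomial that occurs in `tutteBasis k m i`, with coefficient one, and in no
other member of the family. -/
def leadingExponent (k m : ℕ) : WithBot (Fin k × Fin m) → ℕ × ℕ
  | ⊥ => (k, 0)
  | WithBot.some x => succPair x

theorem shiftedCoeff_tutteExcess_succPair {k m : ℕ} (x y : Fin k × Fin m) :
    shiftedCoeff (succPair x) (tutteExcess (succPair y)) = if y = x then 1 else 0 := by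
  have h_lower : ((succPair y).1 - (succPair y).2, (succPair y).2 - (succPair y).1) ≠
      succPair x := by
    simp only [succPair, ne_eq, Prod.mk.injEq]
    omega
  simp only [shiftedCoeff_tutteExcess, succPair_injective.eq_iff, if_neg h_lower, sub_zero]

theorem shiftedCoeff_rank_tutteExcess_succPair {k m : ℕ} (x : Fin k × Fin m) :
    shiftedCoeff (k, 0) (tutteExcess (succPair x)) = 0 := by
  have hx := x.1.isLt
  rw [shiftedCoeff_tutteExcess, if_neg, if_neg, sub_zero]
  all_goals
    simp only [succPair, Prod.mk.injEq]
    omega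

theorem linearIndependent_tutteBasis (k m : ℕ) : LinearIndependent ℤ (tutteBasis k m) := by
  refine .of_pairwise_dual_eq_zero_one _ (fun i => shiftedCoeff (leadingExponent k m i)) ?_ ?_
  · rintro (_ | x) (_ | y) hne
    · exact absurd rfl hne
    · exact shiftedCoeff_rank_tutteExcess_succPair y
    · exact shiftedCoeff_uniformTutte_of_pos (Nat.succ_pos _) (Nat.succ_pos _) _ _
    · exact (shiftedCoeff_tutteExcess_succPair x y).trans
        (if_neg fun h => hne (congrArg _ h.symm))
  · rintro (_ | x)
    · exact shiftedCoeff_uniformTutte_rank _ _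
    · exact (shiftedCoeff_tutteExcess_succPair x x).trans (if_pos rfl)

theorem tutteExcess_eq_zero_or_exists_succPair_eq {k m : ℕ} {a : ℕ × ℕ} (ha : a ≤ (k, m)) :
    tutteExcess a = 0 ∨ ∃ x : Fin k × Fin m, succPair x = a := by
  obtain ⟨_ | p, _ | q⟩ := a
  · exact .inl (tutteExcess_eq_zero (.inl rfl))
  · exact .inl (tutteExcess_eq_zero (.inl rfl))
  · exact .inl (tutteExcess_eq_zero (.inr rfl))
  · exact .inr ⟨(⟨p, ha.1⟩, ⟨q, ha.2⟩), rfl⟩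

theorem tutteExcess_mem_span_range_tutteBasis {k m : ℕ} {a : ℕ × ℕ} (ha : a ≤ (k, m)) :
    tutteExcess a ∈ Submodule.span ℤ (Set.range (tutteBasis k m)) := by
  obtain h | ⟨x, rfl⟩ := tutteExcess_eq_zero_or_exists_succPair_eq ha
  · exact h ▸ zero_mem _
  · exact Submodule.subset_span ⟨x, rfl⟩

theorem tutteExcess_mem_span_image_Iio {k m : ℕ} {x : Fin k × Fin m} {a : ℕ × ℕ}
    (ha : a < succPair x) :
    tutteExcess a ∈ Submodule.span ℤ (tutteBasis k m '' Set.Iio ↑x) := by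
  obtain h | ⟨y, rfl⟩ := tutteExcess_eq_zero_or_exists_succPair_eq (ha.le.trans (succPair_le x))
  · exact h ▸ zero_mem _
  · exact Submodule.subset_span ⟨y, WithBot.coe_lt_coe.2 (succPair_lt_succPair.1 ha), rfl⟩

end TuttePolynomials

section MatroidLemmas

open Matroid

variable {α : Type*} {M : Matroid α} {X : Set α}

theorem encard_add_eRank_le (hX : X ⊆ M.E) : X.encard + M.eRank ≤ M.E.encard + M.eRk X := by
  have h_rank : M.eRank ≤ M.eRk X + (M.E \ X).encard := by
    rw [← M.eRk_ground]
    nth_rw 1 [← Set.union_sdiff_cancel hX]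
    exact M.eRk_union_le_eRk_add_encard X (M.E \ X)
  calc X.encard + M.eRank ≤ X.encard + (M.eRk X + (M.E \ X).encard) := by gcongr
    _ = M.E.encard + M.eRk X := by rw [← Set.encard_sdiff_add_encard_of_subset hX]; ring

theorem tutte_eq_uniformTutte_add_sum_tutteExcess (M : Matroid α) [M.Finite] :
    M.tutte = uniformTutte M.E.ncard M.eRank.toNat +
      ∑ A ∈ M.ground_finite.toFinset.powerset,
        tutteExcess (M.eRank.toNat - (M.eRk A).toNat, A.card - (M.eRk A).toNat) := by
  have h_uniform : uniformTutte M.E.ncard M.eRank.toNat =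
      ∑ A ∈ M.ground_finite.toFinset.powerset,
        tutteMonomial (M.eRank.toNat - A.card, A.card - M.eRank.toNat) := by
    rw [Finset.sum_powerset_apply_card
      (fun s => tutteMonomial (M.eRank.toNat - s, s - M.eRank.toNat)),
      ← Set.ncard_eq_toFinset_card M.E M.ground_finite, uniformTutte]
  rw [h_uniform, ← Finset.sum_add_distrib, tutte]
  refine Finset.sum_congr rfl fun A _ => ?_
  have h_rank : (M.eRk A).toNat ≤ M.eRank.toNat :=
    ENat.toNat_le_toNat (M.eRk_le_eRank A) (M.eRank_ne_top_iff.2 inferInstance)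
  have h_card : (M.eRk A).toNat ≤ A.card := by
    simpa using ENat.toNat_le_toNat (M.eRk_le_encard A) A.finite_toSet.encard_lt_top.ne
  have h_corank : M.eRank.toNat - (M.eRk A).toNat - (A.card - (M.eRk A).toNat) =
      M.eRank.toNat - A.card := by omega
  have h_nullity : A.card - (M.eRk A).toNat - (M.eRank.toNat - (M.eRk A).toNat) =
      A.card - M.eRank.toNat := by omega
  rw [tutteExcess, h_corank, h_nullity, add_sub_cancel, tutteMonomial]

theorem tutte_mem_span_range_tutteBasis (M : Matroid α) [M.Finite] {k m : ℕ}
    (hE : M.E.encard = (k + m : ℕ)) (hk : M.eRank = k) :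
    M.tutte ∈ Submodule.span ℤ (Set.range (tutteBasis k m)) := by
  rw [tutte_eq_uniformTutte_add_sum_tutteExcess, hk, ENat.toNat_natCast, Set.ncard, hE,
    ENat.toNat_natCast]
  refine add_mem (Submodule.subset_span ⟨⊥, rfl⟩) (sum_mem fun A hA => ?_)
  have hA : (A : Set α) ⊆ M.E := by simpa [← Finset.coe_subset] using hA
  refine tutteExcess_mem_span_range_tutteBasis ⟨Nat.sub_le _ _, ?_⟩
  have h := encard_add_eRank_le hA
  obtain ⟨r, hr⟩ := ENat.ne_top_iff_exists.1 (M.isRkFinite_set (A : Set α)).eRk_lt_top.ne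
  rw [hk, hE, ← hr, Set.encard_coe_eq_coe_finsetCard] at h
  norm_cast at h
  rw [← hr, ENat.toNat_natCast]
  dsimp only
  omega

end MatroidLemmas

section StressedSubsets

open Matroid

variable {α : Type*} {M : Matroid α} {A B F I S X : Set α}

theorem indep_of_isUniform (hM : M.IsUniform) (hI : I ⊆ M.E) (hle : I.encard ≤ M.eRank) :
    M.Indep I := by
  obtain ⟨B, hIB, hBE, hB⟩ :=
    Set.exists_superset_subset_encard_eq hI hle M.eRank_le_encard_ground
  exact (hM B hBE hB).indep.subset hIB

theorem spanning_of_isUniform (hM : M.IsUniform) (hX : X ⊆ M.E) (hle : M.eRank ≤ X.encard) :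
    M.Spanning X := by
  obtain ⟨B, hBX, hB⟩ := Set.exists_subset_encard_eq hle
  exact (hM B (hBX.trans hX) hB).spanning_of_superset hBX hX

theorem isUniform_of_forall_spanning [M.RankFinite]
    (h : ∀ B ⊆ M.E, B.encard = M.eRank → M.Spanning B) : M.IsUniform := by
  intro B hBE hB
  have hle : M.eRank ≤ M.eRk B := (h B hBE hB).eRk_eq.ge
  have h_indep : M.Indep B := (M.isRkFinite_set B).indep_of_encard_le_eRk (hB.trans_le hle)
  exact h_indep.isBase_of_eRk_ge h_indep.finite hle

theorem isCyclicFlat_iff :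
    M.IsCyclicFlat F ↔ M.IsFlat F ∧ ∀ e ∈ F, e ∈ M.closure (F \ {e}) := by
  refine and_congr_right fun hF => ⟨?_, fun h => ?_⟩
  · rintro ⟨𝒞, h𝒞, rfl⟩ e ⟨C, hC, heC⟩
    exact M.closure_subset_closure (Set.sdiff_subset_sdiff_left (Set.subset_sUnion_of_mem hC))
      ((h𝒞 C hC).mem_closure_sdiff_singleton_of_mem heC)
  · refine ⟨{C | M.IsCircuit C ∧ C ⊆ F}, fun C hC => hC.1,
      Set.Subset.antisymm (fun e he => ?_) (Set.sUnion_subset fun C hC => hC.2)⟩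
    have heF : e ∉ F \ {e} := fun h => h.2 rfl
    obtain ⟨C, hCF, hC, heC⟩ := (mem_closure_iff_exists_isCircuit heF).1 (h e he)
    rw [Set.insert_sdiff_singleton, Set.insert_eq_of_mem he] at hCF
    exact ⟨C, ⟨hC, hCF⟩, heC⟩

theorem eRk_sdiff_singleton_of_isCyclicFlat {e : α} (hF : M.IsCyclicFlat F) (he : e ∈ F) :
    M.eRk (F \ {e}) = M.eRk F := by
  rw [← M.eRk_closure_eq, ← closure_insert_eq_of_mem_closure ((isCyclicFlat_iff.1 hF).2 e he),
    M.eRk_closure_eq, Set.insert_sdiff_singleton, Set.insert_eq_of_mem he]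

theorem eRk_insert_of_isFlat {e : α} (hF : M.IsFlat F) (he : e ∈ M.E \ F) :
    M.eRk (insert e F) = M.eRk F + 1 :=
  eRk_insert_eq_add_one (by rwa [hF.closure])

theorem isElementarySplit_iff : M.IsElementarySplit ↔ ∀ S ⊆ M.E, S.encard = M.eRank →
    M.IsBase S ∨ ∃ A, M.IsStressed A ∧ S ∈ M.cusp A := by
  have h_mem (S : Set α) :
      S ∈ M.relaxedBases ↔ M.IsBase S ∨ ∃ A, M.IsStressed A ∧ S ∈ M.cusp A := by
    simp only [relaxedBases, Set.mem_union, Set.mem_ofPred_eq, Set.mem_iUnion, exists_prop,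
      and_assoc]
    refine or_congr_right (exists_congr fun A => and_congr_right fun _ => ?_)
    exact and_iff_right_of_imp fun hS => ⟨S, hS⟩
  have h_sub : M.relaxedBases ⊆ {S | S ⊆ M.E ∧ S.encard = M.eRank} := by
    intro S hS
    obtain hS | ⟨A, -, hS⟩ := (h_mem S).1 hS
    · exact ⟨hS.subset_ground, hS.encard_eq_eRank⟩
    · exact ⟨hS.1, hS.2.1⟩
  refine ⟨fun h S hSE hS => (h_mem S).1 (h.superset ⟨hSE, hS⟩), fun h => ?_⟩
  exact h_sub.antisymm fun S hS => (h_mem S).2 (h S hS.1 hS.2)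

theorem eRk_lt_encard_inter_of_mem_cusp [M.RankFinite] (hS : S ∈ M.cusp A) :
    M.eRk A < (S ∩ A).encard :=
  (ENat.add_one_le_iff (M.isRkFinite_set A).eRk_lt_top.ne).1 hS.2.2

theorem eRk_lt_encard_of_mem_cusp [M.RankFinite] (hS : S ∈ M.cusp A) : M.eRk A < A.encard :=
  (eRk_lt_encard_inter_of_mem_cusp hS).trans_le (Set.encard_le_encard Set.inter_subset_right)

theorem eRk_lt_eRank_of_mem_cusp [M.RankFinite] (hS : S ∈ M.cusp A) : M.eRk A < M.eRank :=
  hS.2.1 ▸ (eRk_lt_encard_inter_of_mem_cusp hS).trans_le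
    (Set.encard_le_encard Set.inter_subset_left)

-- A loop of the uniform matroid `M ／ A` would force its rank to be zero.
theorem isFlat_of_isStressed (hA : M.IsStressed A) (hlt : M.eRk A < M.eRank) : M.IsFlat A := by
  obtain ⟨hAE, -, h_contract⟩ := hA
  refine isFlat_iff_closure_eq.2 (Set.Subset.antisymm (fun e he => ?_) (M.subset_closure A))
  by_contra heA
  have h_loop : (M ／ A).IsLoop e := contract_isLoop_iff_mem_closure.2 ⟨he, heA⟩
  obtain h_rank | h_rank := eq_or_ne (M ／ A).eRank 0
  · have h_spanning : (M ／ A).Spanning ∅ :=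
      spanning_of_isUniform h_contract (Set.empty_subset _) (by simp [h_rank])
    rw [contract_spanning_iff, Set.empty_union] at h_spanning
    exact hlt.ne h_spanning.1.eRk_eq
  · have h_indep : (M ／ A).Indep {e} :=
      indep_of_isUniform h_contract (Set.singleton_subset_iff.2 h_loop.mem_ground)
        (by simpa [Order.one_le_iff_ne_zero] using h_rank)
    exact h_loop.not_isNonloop (h_indep.isNonloop_of_mem rfl)

theorem isCyclicFlat_of_isStressed (hA : M.IsStressed A) (h_rank : M.eRk A < M.eRank)
    (h_card : M.eRk A < A.encard) : M.IsCyclicFlat A := by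
  refine isCyclicFlat_iff.2 ⟨isFlat_of_isStressed hA h_rank, fun e he => ?_⟩
  have h_le : M.eRk A ≤ (A \ {e}).encard := by
    rw [← Set.encard_sdiff_singleton_add_one he] at h_card
    exact Order.le_of_lt_add_one h_card
  have h_spanning : (M ↾ A).Spanning (A \ {e}) :=
    spanning_of_isUniform hA.2.1 Set.sdiff_subset (by rwa [eRank_restrict])
  exact ((restrict_spanning_iff Set.sdiff_subset hA.1).1 h_spanning) he

theorem eq_of_subset_of_isFlat_of_isUniform_restrict (hA : M.IsFlat A)
    (h_dep : M.eRk A < A.encard) (hB : (M ↾ B).IsUniform) (hBE : B ⊆ M.E) (hAB : A ⊆ B) :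
    A = B := by
  rcases le_total (M.eRk B) A.encard with h_le | h_le
  · have h_spanning : (M ↾ B).Spanning A :=
      spanning_of_isUniform hB hAB (by rwa [eRank_restrict])
    exact hAB.antisymm (((restrict_spanning_iff hAB hBE).1 h_spanning).trans hA.closure.subset)
  · have h_indep : (M ↾ B).Indep A := indep_of_isUniform hB hAB (by rwa [eRank_restrict])
    exact absurd h_indep.of_restrict.eRk_eq_encard h_dep.ne

theorem eq_of_isSchubert_of_isStressed [M.RankFinite] {T : Set α} (hM : M.IsSchubert)
    (hA : M.IsStressed A) (hB : M.IsStressed B) (hS : S ∈ M.cusp A) (hT : T ∈ M.cusp B) :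
    A = B := by
  have hA_rank := eRk_lt_eRank_of_mem_cusp hS
  have hA_card := eRk_lt_encard_of_mem_cusp hS
  have hB_rank := eRk_lt_eRank_of_mem_cusp hT
  have hB_card := eRk_lt_encard_of_mem_cusp hT
  obtain h | h := hM.total (isCyclicFlat_of_isStressed hA hA_rank hA_card)
    (isCyclicFlat_of_isStressed hB hB_rank hB_card)
  · exact eq_of_subset_of_isFlat_of_isUniform_restrict (isFlat_of_isStressed hA hA_rank)
      hA_card hB.2.1 hB.1 h
  · exact (eq_of_subset_of_isFlat_of_isUniform_restrict (isFlat_of_isStressed hB hB_rank)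
      hB_card hA.2.1 hA.1 h).symm

theorem isBase_iff_of_isCuspidal [M.RankFinite] (hM : M.IsCuspidal) (hA : M.IsStressed A)
    (hS : S ∈ M.cusp A) :
    M.IsBase B ↔ B ⊆ M.E ∧ B.encard = M.eRank ∧ (B ∩ A).encard ≤ M.eRk A := by
  constructor
  · intro hB
    refine ⟨hB.subset_ground, hB.encard_eq_eRank, ?_⟩
    exact (hB.indep.inter_right A).encard_le_eRk_of_subset Set.inter_subset_right
  · rintro ⟨hBE, h_card, h_inter⟩
    obtain hB | ⟨D, hD, hBD⟩ := isElementarySplit_iff.1 hM.2 B hBE h_card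
    · exact hB
    · obtain rfl := eq_of_isSchubert_of_isStressed hM.1 hA hD hS hBD
      exact absurd h_inter (eRk_lt_encard_inter_of_mem_cusp hBD).not_ge

end StressedSubsets

section CuspidalMatroid

open Matroid

variable {α : Type*} [Finite α] {A F I S : Set α} {r k : ℕ}

theorem encard_eq_natCast_iff {j : ℕ} : S.encard = j ↔ S.ncard = j := by
  rw [← (Set.toFinite S).cast_ncard_eq, Nat.cast_inj]

theorem ncard_insert_inter_le (e : α) (I A : Set α) :
    (insert e I ∩ A).ncard ≤ (I ∩ A).ncard + 1 := by
  have h : insert e I ∩ A ⊆ insert e (I ∩ A) :=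
    Set.insert_inter_distrib e I A ▸ Set.inter_subset_inter_right _ (Set.subset_insert e A)
  exact (Set.ncard_le_ncard h).trans (Set.ncard_insert_le e _)

theorem exists_ncard_insert_inter_le (hI : (I ∩ A).ncard ≤ r) (hS : I.ncard < S.ncard)
    (hSA : I.ncard < r + (S \ A).ncard) : ∃ e ∈ S, e ∉ I ∧ (insert e I ∩ A).ncard ≤ r := by
  obtain hlt | heq := hI.lt_or_eq
  · obtain ⟨e, heS, heI⟩ := Set.exists_mem_notMem_of_ncard_lt_ncard hS
    exact ⟨e, heS, heI, (ncard_insert_inter_le e I A).trans hlt⟩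
  · have h_split := Set.ncard_inter_add_ncard_sdiff_eq_ncard I A
    have h_sdiff : (I \ A).ncard < (S \ A).ncard := by omega
    obtain ⟨e, ⟨heS, heA⟩, heI⟩ := Set.exists_mem_notMem_of_ncard_lt_ncard h_sdiff
    refine ⟨e, heS, fun h => heI ⟨h, heA⟩, ?_⟩
    rwa [Set.insert_inter_of_notMem heA]

/-- The matroid on the whole type whose independent sets are the sets with at most `k` elements,
of which at most `r` belong to `A`. -/
def cuspidalMatroid (A : Set α) (r k : ℕ) : Matroid α :=
  (IndepMatroid.ofFinite (E := Set.univ) Set.finite_univ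
    (fun I => I.ncard ≤ k ∧ (I ∩ A).ncard ≤ r) (by simp)
    (fun I J hJ hIJ => ⟨(Set.ncard_le_ncard hIJ).trans hJ.1,
      (Set.ncard_le_ncard (Set.inter_subset_inter_left A hIJ)).trans hJ.2⟩)
    (by
      rintro I J ⟨-, hIA⟩ ⟨hJ, hJA⟩ hlt
      have h_split := Set.ncard_inter_add_ncard_sdiff_eq_ncard J A
      obtain ⟨e, heJ, heI, he⟩ := exists_ncard_insert_inter_le hIA hlt (by omega)
      exact ⟨e, heJ, heI, (Set.ncard_insert_le e I).trans (hlt.trans_le hJ), he⟩)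
    (fun I _ => Set.subset_univ I)).matroid

theorem cuspidalMatroid_ground : (cuspidalMatroid A r k).E = Set.univ := rfl

theorem cuspidalMatroid_indep_iff :
    (cuspidalMatroid A r k).Indep I ↔ I.ncard ≤ k ∧ (I ∩ A).ncard ≤ r := Iff.rfl

theorem cuspidalMatroid_eRk (A S : Set α) (r k : ℕ) :
    (cuspidalMatroid A r k).eRk S = (min (min S.ncard k) (r + (S \ A).ncard) : ℕ) := by
  obtain ⟨I, hI⟩ := (cuspidalMatroid A r k).exists_isBasis S (Set.subset_univ S)
  rw [← hI.encard_eq_eRk, encard_eq_natCast_iff]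
  obtain ⟨hIk, hIr⟩ := cuspidalMatroid_indep_iff.1 hI.indep
  refine le_antisymm ?_ ?_
  · have h_split := Set.ncard_inter_add_ncard_sdiff_eq_ncard I A
    have h_sdiff : (I \ A).ncard ≤ (S \ A).ncard :=
      Set.ncard_le_ncard (Set.sdiff_subset_sdiff_left hI.subset)
    have h_sub : I.ncard ≤ S.ncard := Set.ncard_le_ncard hI.subset
    omega
  · by_contra! hlt
    simp only [lt_min_iff] at hlt
    obtain ⟨e, heS, heI, he⟩ := exists_ncard_insert_inter_le hIr hlt.1.1 hlt.2
    exact (hI.insert_dep ⟨heS, heI⟩).not_indep (cuspidalMatroid_indep_iff.2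
      ⟨(Set.ncard_insert_le e I).trans hlt.1.2, he⟩)

theorem cuspidalMatroid_eRank (hk : k ≤ Nat.card α) (hA : k ≤ r + Aᶜ.ncard) :
    (cuspidalMatroid A r k).eRank = k := by
  rw [← eRk_ground, cuspidalMatroid_eRk, cuspidalMatroid_ground, Set.ncard_univ,
    ← Set.compl_eq_univ_sdiff, min_eq_right hk, min_eq_left hA]

theorem cuspidalMatroid_isBase_iff (hk : k ≤ Nat.card α) (hA : k ≤ r + Aᶜ.ncard) :
    (cuspidalMatroid A r k).IsBase S ↔ S.ncard = k ∧ (S ∩ A).ncard ≤ r := by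
  have h_rank := cuspidalMatroid_eRank hk hA
  constructor
  · intro hS
    exact ⟨encard_eq_natCast_iff.1 (hS.encard_eq_eRank.trans h_rank), hS.indep.2⟩
  · rintro ⟨hSk, hSr⟩
    have hS : (cuspidalMatroid A r k).Indep S := ⟨hSk.le, hSr⟩
    refine hS.isBase_of_eRk_ge hS.finite ?_
    rw [h_rank, hS.eRk_eq_encard, encard_eq_natCast_iff.2 hSk]

theorem cuspidalMatroid_mapEquiv (e : α ≃ α) :
    (cuspidalMatroid A r k).mapEquiv e = cuspidalMatroid (e '' A) r k := by
  refine ext_indep (by simp [cuspidalMatroid_ground]) fun I _ => ?_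
  have h_inter : I ∩ e '' A = e '' (e.symm '' I ∩ A) := by
    rw [Set.image_inter e.injective, e.image_symm_image]
  rw [mapEquiv_indep_iff, cuspidalMatroid_indep_iff, cuspidalMatroid_indep_iff, h_inter,
    Set.ncard_image_of_injective _ e.symm.injective, Set.ncard_image_of_injective _ e.injective]

theorem eq_of_isCyclicFlat_cuspidalMatroid (hF : (cuspidalMatroid A r k).IsCyclicFlat F) :
    F = ∅ ∨ F = A ∨ F = Set.univ := by
  have h_remove : ∀ e ∈ F, _ := fun e he => eRk_sdiff_singleton_of_isCyclicFlat hF he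
  have h_insert : ∀ e ∉ F, _ := fun e he => eRk_insert_of_isFlat hF.1 ⟨Set.mem_univ e, he⟩
  simp only [cuspidalMatroid_eRk] at h_remove h_insert
  norm_cast at h_remove h_insert
  refine or_iff_not_imp_left.2 fun h_ne => or_iff_not_imp_right.2 fun h_univ => ?_
  obtain ⟨e, he⟩ := Set.nonempty_iff_ne_empty.2 h_ne
  obtain ⟨f, hf⟩ := (Set.ne_univ_iff_exists_notMem F).1 h_univ
  have h_card := Set.ncard_sdiff_singleton_add_one he
  have he_rank := h_remove e he
  have hf_rank := h_insert f hf
  refine Set.Subset.antisymm (fun x hx => ?_) (fun x hx => ?_)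
  · by_contra hxA
    have hx_rank := h_remove x hx
    have hx_card := Set.ncard_sdiff_singleton_add_one (show x ∈ F \ A from ⟨hx, hxA⟩)
    rw [sdiff_right_comm] at hx_rank
    omega
  · by_contra hxF
    have hx_rank := h_insert x hxF
    rw [Set.insert_sdiff_of_mem _ hx] at hx_rank
    omega

theorem cuspidalMatroid_isSchubert (A : Set α) (r k : ℕ) :
    (cuspidalMatroid A r k).IsSchubert := by
  intro F hF G hG h_ne
  obtain rfl | rfl | rfl := eq_of_isCyclicFlat_cuspidalMatroid hF
  · exact .inl (Set.empty_subset G)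
  · obtain rfl | rfl | rfl := eq_of_isCyclicFlat_cuspidalMatroid hG
    · exact .inr (Set.empty_subset F)
    · exact absurd rfl h_ne
    · exact .inl (Set.subset_univ F)
  · exact .inr (Set.subset_univ G)

theorem cuspidalMatroid_restrict_isUniform (A : Set α) (r k : ℕ) :
    (cuspidalMatroid A r k ↾ A).IsUniform := by
  refine isUniform_of_forall_spanning fun B (hBA : B ⊆ A) hB =>
    (spanning_iff_eRk_le (M := cuspidalMatroid A r k ↾ A) hBA).2 ?_
  rw [eRank_restrict, cuspidalMatroid_eRk, encard_eq_natCast_iff] at hB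
  rw [eRank_restrict, restrict_eRk_eq _ hBA, cuspidalMatroid_eRk, cuspidalMatroid_eRk, hB,
    Set.sdiff_eq_empty.2 hBA, Set.sdiff_self, Nat.cast_le]
  omega

-- The rank of `B ∪ A`, for `B` disjoint from `A`, depends on the cardinality of `B` only.
theorem cuspidalMatroid_contract_isUniform (A : Set α) (r k : ℕ) :
    (cuspidalMatroid A r k ／ A).IsUniform := by
  have hA : A ⊆ (cuspidalMatroid A r k).E := Set.subset_univ A
  refine isUniform_of_forall_spanning fun B hB h_card => ?_
  have hBA : Disjoint B A := (Set.subset_sdiff.1 hB).2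
  obtain ⟨B', hB'⟩ := (cuspidalMatroid A r k ／ A).exists_isBase
  obtain ⟨h_spanning, hBA'⟩ := (contract_spanning_iff hA).1 hB'.spanning
  have h_eq : B.ncard = B'.ncard := by
    rw [Set.ncard, Set.ncard, h_card, hB'.encard_eq_eRank]
  refine (contract_spanning_iff hA).2 ⟨(spanning_iff_eRk_le (Set.subset_univ _)).2 ?_, hBA⟩
  rw [← h_spanning.eRk_eq, cuspidalMatroid_eRk, cuspidalMatroid_eRk,
    Set.ncard_union_eq hBA, Set.ncard_union_eq hBA', Set.union_sdiff_cancel_right hBA.inter_eq.le,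
    Set.union_sdiff_cancel_right hBA'.inter_eq.le, h_eq]

theorem cuspidalMatroid_isStressed (A : Set α) (r k : ℕ) :
    (cuspidalMatroid A r k).IsStressed A :=
  ⟨Set.subset_univ A, cuspidalMatroid_restrict_isUniform A r k,
    cuspidalMatroid_contract_isUniform A r k⟩

theorem cuspidalMatroid_isElementarySplit (A : Set α) (r k : ℕ) :
    (cuspidalMatroid A r k).IsElementarySplit := by
  refine isElementarySplit_iff.2 fun S hSE hS => ?_
  have h_card : S.ncard ≤ k := by
    rw [← eRk_ground, cuspidalMatroid_eRk, encard_eq_natCast_iff] at hS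
    omega
  obtain h_inter | h_inter := le_or_gt (S ∩ A).ncard r
  · have h_indep : (cuspidalMatroid A r k).Indep S := ⟨h_card, h_inter⟩
    exact .inl (h_indep.isBase_of_eRk_ge h_indep.finite (h_indep.eRk_eq_encard.trans hS).ge)
  · refine .inr ⟨A, cuspidalMatroid_isStressed A r k, hSE, hS, ?_⟩
    rw [cuspidalMatroid_eRk, Set.sdiff_self, Set.ncard_empty, ← (Set.toFinite _).cast_ncard_eq]
    norm_cast
    omega

theorem cuspidalMatroid_isCuspidal (A : Set α) (r k : ℕ) :
    (cuspidalMatroid A r k).IsCuspidal :=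
  ⟨cuspidalMatroid_isSchubert A r k, cuspidalMatroid_isElementarySplit A r k⟩

end CuspidalMatroid

section CuspidalMatroidTutte

open Matroid

variable {α : Type*} [Finite α] {A S : Set α} {r k m : ℕ}

theorem tutteExcess_sub_min (a b r k : ℕ) :
    tutteExcess (k - min (min (a + b) k) (r + b), a + b - min (min (a + b) k) (r + b)) =
      tutteExcess (k - r - b, a - r) := by
  obtain h_small | h_corank | h_eq : a ≤ r ∨ k ≤ r + b ∧ r < a ∨ r + b < k ∧ r < a := by omega
  · rw [tutteExcess_eq_zero, tutteExcess_eq_zero] <;> dsimp only <;> omega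
  · rw [tutteExcess_eq_zero, tutteExcess_eq_zero] <;> dsimp only <;> omega
  · congr 2 <;> omega

theorem cuspidalMatroid_tutte (hk : k ≤ Nat.card α) (hA : k ≤ r + Aᶜ.ncard) :
    (cuspidalMatroid A r k).tutte = uniformTutte (Nat.card α) k +
      ∑ S ∈ (cuspidalMatroid A r k).ground_finite.toFinset.powerset,
        tutteExcess (k - r - (↑S \ A).ncard, (↑S ∩ A).ncard - r) := by
  have h_ground : (cuspidalMatroid A r k).E.ncard = Nat.card α := Set.ncard_univ α
  rw [tutte_eq_uniformTutte_add_sum_tutteExcess, cuspidalMatroid_eRank hk hA,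
    ENat.toNat_natCast, h_ground]
  refine congrArg _ (Finset.sum_congr rfl fun S _ => ?_)
  rw [cuspidalMatroid_eRk, ENat.toNat_natCast, ← Set.ncard_coe_finset,
    ← Set.ncard_inter_add_ncard_sdiff_eq_ncard (S : Set α) A, tutteExcess_sub_min]

theorem cuspidalMatroid_empty_tutte (hk : k ≤ Nat.card α) :
    (cuspidalMatroid (∅ : Set α) 0 k).tutte = uniformTutte (Nat.card α) k := by
  rw [cuspidalMatroid_tutte hk (by simpa), Finset.sum_eq_zero, add_zero]
  intro S _
  exact tutteExcess_eq_zero (.inr (by simp))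

theorem prod_sdiff_inter_lt (hrA : r < A.ncard) (hrk : r < k) (hS : S ≠ A) :
    (k - r - (S \ A).ncard, (S ∩ A).ncard - r) < (k - r, A.ncard - r) := by
  have h_inter : (S ∩ A).ncard ≤ A.ncard := Set.ncard_le_ncard Set.inter_subset_right
  rw [Prod.mk_lt_mk]
  by_contra! h
  have h_sdiff : (S \ A).ncard = 0 := by omega
  have h_sub : S ⊆ A := by rwa [Set.ncard_eq_zero, Set.sdiff_eq_empty] at h_sdiff
  refine hS (Set.eq_of_subset_of_ncard_le h_sub ?_)
  rw [Set.inter_eq_left.2 h_sub] at h h_inter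
  omega

theorem cuspidalMatroid_tutte_sub_tutteBasis_mem (hα : Nat.card α = k + m)
    (hA : k ≤ r + Aᶜ.ncard) {x : Fin k × Fin m} (hx : succPair x = (k - r, A.ncard - r)) :
    (cuspidalMatroid A r k).tutte - tutteBasis k m x ∈
      Submodule.span ℤ (tutteBasis k m '' Set.Iio ↑x) := by
  classical
  obtain ⟨h_corank, h_nullity⟩ : (x.1 : ℕ) + 1 = k - r ∧ (x.2 : ℕ) + 1 = A.ncard - r :=
    Prod.ext_iff.1 hx
  have h_uniform : uniformTutte (k + m) k ∈
      Submodule.span ℤ (tutteBasis k m '' Set.Iio ↑x) :=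
    Submodule.subset_span ⟨⊥, WithBot.bot_lt_coe x, rfl⟩
  have h_lead : tutteExcess (k - r - (A \ A).ncard, (A ∩ A).ncard - r) = tutteBasis k m x := by
    rw [Set.sdiff_self, Set.ncard_empty, Set.inter_self, Nat.sub_zero, ← hx]
    rfl
  have hA_mem : (Set.toFinite A).toFinset ∈
      (cuspidalMatroid A r k).ground_finite.toFinset.powerset := by
    simp [← Finset.coe_subset, cuspidalMatroid_ground]
  rw [cuspidalMatroid_tutte (by omega) hA, hα, ← Finset.add_sum_erase _ _ hA_mem,
    Set.Finite.coe_toFinset, h_lead, add_left_comm, add_sub_cancel_left]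
  refine add_mem h_uniform (sum_mem fun S hS => tutteExcess_mem_span_image_Iio (hx ▸ ?_))
  refine prod_sdiff_inter_lt (by omega) (by omega) fun h_eq => Finset.ne_of_mem_erase hS ?_
  rw [← Finset.coe_inj, Set.Finite.coe_toFinset, h_eq]

end CuspidalMatroidTutte

section Classification

open Matroid

variable {α : Type*} [Finite α] {M : Matroid α} {A S : Set α} {k : ℕ}

theorem eq_cuspidalMatroid_empty_of_isUniform (hM : M.IsUniform) (hE : M.E = Set.univ)
    (hk : M.eRank = k) : M = cuspidalMatroid ∅ 0 k := by
  have hkα : k ≤ Nat.card α := by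
    have h := M.eRank_le_encard_ground
    rwa [hk, hE, Set.encard_univ, ENat.card_eq_coe_natCard, Nat.cast_le] at h
  refine ext_isBase hE fun B hB => ?_
  rw [cuspidalMatroid_isBase_iff hkα (by simpa), ← encard_eq_natCast_iff, ← hk, Set.inter_empty,
    Set.ncard_empty, and_iff_left le_rfl]
  exact ⟨IsBase.encard_eq_eRank, hM B hB⟩

theorem eq_cuspidalMatroid_of_isCuspidal {r : ℕ} (hM : M.IsCuspidal) (hE : M.E = Set.univ)
    (hk : M.eRank = k) (hA : M.IsStressed A) (hS : S ∈ M.cusp A) (hr : M.eRk A = r)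
    (hkα : k ≤ Nat.card α) (hAc : k ≤ r + Aᶜ.ncard) : M = cuspidalMatroid A r k := by
  refine ext_isBase hE fun B hB => ?_
  rw [isBase_iff_of_isCuspidal hM hA hS, cuspidalMatroid_isBase_iff hkα hAc, and_iff_right hB,
    hk, hr, encard_eq_natCast_iff, ← (Set.toFinite (B ∩ A)).cast_ncard_eq, Nat.cast_le]

theorem exists_eq_cuspidalMatroid_of_isCuspidal (hM : M.IsCuspidal) (hE : M.E = Set.univ)
    (hk : M.eRank = k) : M = cuspidalMatroid ∅ 0 k ∨ ∃ (A : Set α) (r : ℕ),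
      r < k ∧ r < A.ncard ∧ k ≤ r + Aᶜ.ncard ∧ M = cuspidalMatroid A r k := by
  by_cases h_uniform : M.IsUniform
  · exact .inl (eq_cuspidalMatroid_empty_of_isUniform h_uniform hE hk)
  simp only [IsUniform, not_forall] at h_uniform
  obtain ⟨S, hSE, hSk, hS⟩ := h_uniform
  obtain ⟨A, hA, hSA⟩ := (isElementarySplit_iff.1 hM.2 S hSE hSk).resolve_left hS
  have h_rank := eRk_lt_eRank_of_mem_cusp hSA
  have h_card := eRk_lt_encard_of_mem_cusp hSA
  have h_compl : M.eRank ≤ M.eRk A + Aᶜ.encard := by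
    have h := M.eRk_union_le_eRk_add_encard A Aᶜ
    rwa [Set.union_compl_self, ← hE, eRk_ground] at h
  obtain ⟨r, hr⟩ := ENat.ne_top_iff_exists.1 h_rank.ne_top
  rw [hk, ← hr, Nat.cast_lt] at h_rank
  rw [← hr, ← (Set.toFinite A).cast_ncard_eq, Nat.cast_lt] at h_card
  rw [hk, ← hr, ← (Set.toFinite Aᶜ).cast_ncard_eq] at h_compl
  norm_cast at h_compl
  have h_total := Set.ncard_add_ncard_compl A
  exact .inr ⟨A, r, h_rank, h_card, h_compl,
    eq_cuspidalMatroid_of_isCuspidal hM hE hk hA hSA hr.symm (by omega) h_compl⟩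

end Classification

section CuspidalClasses

open Matroid

variable {k m : ℕ}

theorem exists_perm_image_eq_of_ncard_eq {α : Type*} [Finite α] {A B : Set α}
    (h : A.ncard = B.ncard) : ∃ e : Equiv.Perm α, e '' A = B := by
  classical
  have := Fintype.ofFinite α
  obtain ⟨f⟩ : Nonempty (A ≃ B) := Finite.card_eq.1 h
  refine ⟨f.extendSubtype, Set.eq_of_subset_of_ncard_le ?_ ?_⟩
  · rintro _ ⟨x, hx, rfl⟩
    exact f.extendSubtype_mem x hx
  · rw [Set.ncard_image_of_injective _ f.extendSubtype.injective, h]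

/-- The initial segment with `h` elements of `Fin n`; it serves as the standard subset with `h`
elements. -/
def initialSegment (n h : ℕ) : Set (Fin n) := {x | (x : ℕ) < h}

theorem ncard_initialSegment {n h : ℕ} (hn : h ≤ n) : (initialSegment n h).ncard = h := by
  have h_range : initialSegment n h = Set.range (Fin.castLE hn) := by
    simp only [initialSegment, Fin.range_castLE]
  rw [h_range, ← Set.image_univ, Set.ncard_image_of_injective _ (Fin.castLE_injective hn),
    Set.ncard_univ, Nat.card_fin]

/-- The matroid `cuspidalMatroid A r k` as a member of the set of cuspidal matroids of rank `k` on
`Fin n`. -/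
def cuspidalOn {n : ℕ} (A : Set (Fin n)) (r k : ℕ) (hk : k ≤ n) (hA : k ≤ r + Aᶜ.ncard) :
    CuspidalOn n k :=
  ⟨cuspidalMatroid A r k, rfl, cuspidalMatroid_eRank (by rwa [Nat.card_fin]) hA,
    cuspidalMatroid_isCuspidal A r k⟩

/-- The stressed set of the representative with index `(i, j)`: its rank is `k - (i + 1)` and its
nullity is `j + 1`. -/
def standardStressedSet (x : Fin k × Fin m) : Set (Fin (k + m)) :=
  initialSegment (k + m) (k - (x.1 + 1) + (x.2 + 1))

theorem ncard_standardStressedSet (x : Fin k × Fin m) :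
    (standardStressedSet x).ncard = k - (x.1 + 1) + (x.2 + 1) :=
  ncard_initialSegment (by omega)

theorem le_add_ncard_compl_standardStressedSet (x : Fin k × Fin m) :
    k ≤ k - (x.1 + 1) + (standardStressedSet x)ᶜ.ncard := by
  have h_total := Set.ncard_add_ncard_compl (standardStressedSet x)
  rw [ncard_standardStressedSet, Nat.card_fin] at h_total
  omega

/-- Representatives of the isomorphism classes of cuspidal matroids of rank `k` on `k + m`
elements: the uniform matroid, and one matroid for each rank and nullity of a stressed set. -/
def cuspidalRep (k m : ℕ) : WithBot (Fin k × Fin m) → CuspidalOn (k + m) k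
  | ⊥ => cuspidalOn ∅ 0 k (Nat.le_add_right k m) (by simp)
  | WithBot.some x => cuspidalOn (standardStressedSet x) (k - (x.1 + 1)) k
      (Nat.le_add_right k m) (le_add_ncard_compl_standardStressedSet x)

/-- The isomorphism class of `cuspidalRep k m i`. -/
def cuspidalClassRep (k m : ℕ) (i : WithBot (Fin k × Fin m)) : CuspidalClass (k + m) k :=
  Quotient.mk _ (cuspidalRep k m i)

theorem cuspidalClassRep_surjective (k m : ℕ) : Function.Surjective (cuspidalClassRep k m) := by
  intro q
  induction q using Quotient.inductionOn with
  | _ M =>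
  obtain ⟨M, hE, h_rank, hM⟩ := M
  obtain rfl | ⟨A, r, hrk, hrA, hA, rfl⟩ := exists_eq_cuspidalMatroid_of_isCuspidal hM hE h_rank
  · exact ⟨⊥, rfl⟩
  · have h_total := Set.ncard_add_ncard_compl A
    rw [Nat.card_fin] at h_total
    let x : Fin k × Fin m := (⟨k - r - 1, by omega⟩, ⟨A.ncard - r - 1, by omega⟩)
    have hr : k - (x.1 + 1) = r := by dsimp only [x]; omega
    have h_card : (standardStressedSet x).ncard = A.ncard := by
      rw [ncard_standardStressedSet, hr]
      dsimp only [x]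
      omega
    obtain ⟨e, he⟩ := exists_perm_image_eq_of_ncard_eq h_card
    refine ⟨x, Quotient.sound ⟨e, ?_⟩⟩
    change (cuspidalMatroid (standardStressedSet x) (k - (x.1 + 1)) k).mapEquiv e = _
    rw [cuspidalMatroid_mapEquiv, he, hr]

theorem cuspidalClassRep_bot_tutte (k m : ℕ) :
    (cuspidalClassRep k m ⊥).tutte = tutteBasis k m ⊥ := by
  have h := cuspidalMatroid_empty_tutte (α := Fin (k + m)) (k := k) (by simp)
  rwa [Nat.card_fin] at h

theorem cuspidalClassRep_tutte_sub_tutteBasis_mem (k m : ℕ) (i : WithBot (Fin k × Fin m)) :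
    (cuspidalClassRep k m i).tutte - tutteBasis k m i ∈
      Submodule.span ℤ (tutteBasis k m '' Set.Iio i) := by
  induction i using WithBot.recBotCoe with
  | bot =>
    rw [cuspidalClassRep_bot_tutte, sub_self]
    exact zero_mem _
  | coe x =>
    refine cuspidalMatroid_tutte_sub_tutteBasis_mem (Nat.card_fin _)
      (le_add_ncard_compl_standardStressedSet x) ?_
    rw [ncard_standardStressedSet, add_tsub_cancel_left, Nat.sub_sub_self x.1.isLt]
    rfl

theorem span_range_tutte_cuspidalClass (k m : ℕ) :
    Submodule.span ℤ (Set.range (CuspidalClass.tutte (n := k + m) (k := k))) =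
      Submodule.span ℤ (Set.range (tutteBasis k m)) := by
  rw [← (cuspidalClassRep_surjective k m).range_comp]
  exact span_range_eq_of_sub_mem_span_image_Iio (cuspidalClassRep_tutte_sub_tutteBasis_mem k m)

theorem linearIndependent_tutte_cuspidalClassRep (k m : ℕ) :
    LinearIndependent ℤ fun i => (cuspidalClassRep k m i).tutte :=
  linearIndependent_of_sub_mem_span_image_Iio (linearIndependent_tutteBasis k m)
    (cuspidalClassRep_tutte_sub_tutteBasis_mem k m)

/-- The bijection between the indices of the representatives and the isomorphism classes. -/
noncomputable def cuspidalClassEquiv (k m : ℕ) :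
    WithBot (Fin k × Fin m) ≃ CuspidalClass (k + m) k :=
  .ofBijective (cuspidalClassRep k m)
    ⟨.of_comp (linearIndependent_tutte_cuspidalClassRep k m).injective,
      cuspidalClassRep_surjective k m⟩

theorem card_cuspidalClass (k m : ℕ) : Nat.card (CuspidalClass (k + m) k) = k * m + 1 := by
  rw [← Nat.card_congr (cuspidalClassEquiv k m)]
  exact Finite.card_option.trans (by simp)

theorem linearIndependent_tutte_cuspidalClass (k m : ℕ) :
    LinearIndependent ℤ (CuspidalClass.tutte (n := k + m) (k := k)) :=
  (linearIndependent_equiv' (cuspidalClassEquiv k m) rfl).1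
    (linearIndependent_tutte_cuspidalClassRep k m)

end CuspidalClasses

theorem theoremC (n k : ℕ) (hk : k ≤ n) :
    Nat.card (Matroid.CuspidalClass n k) = k * (n - k) + 1 ∧
    ∀ {α : Type*} (M : Matroid α) [M.Finite], M.E.encard = n → M.eRank = k →
      ∃! c : Matroid.CuspidalClass n k →₀ ℤ, M.tutte = c.sum fun q a => a • q.tutte := by
  obtain ⟨m, rfl⟩ := Nat.exists_eq_add_of_le hk
  refine ⟨by rw [card_cuspidalClass, Nat.add_sub_cancel_left], fun M _ hn hr => ?_⟩
  have h_mem := tutte_mem_span_range_tutteBasis M hn hr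
  rw [← span_range_tutte_cuspidalClass] at h_mem
  obtain ⟨c, hc⟩ := Finsupp.mem_span_range_iff_exists_finsupp.1 h_mem
  refine ⟨c, hc.symm, fun d hd => linearIndependent_tutte_cuspidalClass k m ?_⟩
  rw [Finsupp.linearCombination_apply, Finsupp.linearCombination_apply, hc]
  exact hd.symm
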